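/- Theorem. Let $n\ge 3$, $K=SO(n)$ with normalised Haar measure $dk$, and let $M(n)=\mathbb R^n\rtimes K$ be the Euclidean motion group, with group law $(x_1,k_1)(x_2,k_2)=(x_1+k_1\cdot x_2,\,k_1k_2)$ and Haar measure $dx\,dk$. Let $M\cong SO(n-1)$ be the subgroup of $K$ fixing $e_1=(1,0,\dots,0)$ and $\hat M$ its unitary dual, i.e. the set of unitary equivalence classes of irreducible unitary representations $\sigma:M\to U(d_\sigma)$. For $a>0$ and $\sigma\in\hat M$ let $L^2(K,\mathbb C^{d_\sigma\times d_\sigma};\sigma)$ be the Hilbert space of all $\varphi:K\to\mathbb C^{d_\sigma\times d_\sigma}$ with $\varphi(uk)=\sigma(u)\varphi(k)$ for $u\in M$, $k\in K$, and $\int_K\operatorname{tr}(\varphi(k)^*\varphi(k))\,dk<\infty$; on it $M(n)$ acts by the unitary representation $$(\pi_{a,\sigma}(x,k)\varphi)(s)=e^{ia\langle s^{-1}\cdot e_1,\,x\rangle}\varphi(sk),$$ and for $f\in L^1(M(n))$ put $\hat f(a,\sigma)=\int_{M(n)}f(x,k)\,\pi_{a,\sigma}(x,k)\,dx\,dk$.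 For a bounded operator $T$ let $\|T\|_{S_q}^q=\operatorname{tr}\big((T^*T)^{q/2}\big)\in[0,\infty]$. For $\beta<\frac n2$ let $$f_\beta(x,k)=\chi_{B_1(0)}(x)\,|x|^{-\beta},\qquad (x,k)\in M(n).$$ Then every $f_\beta$ with $\beta<\frac n2$ is compactly supported, square integrable and integrable on $M(n)$, and for every $1<q<2$ there exists $\beta\in(\frac n3,\frac n2)$ such that $$\int_0^\infty\Big(\sum_{\sigma\in\hat M}d_\sigma\,\|\hat f_\beta(a,\sigma)\|_{S_q}^q\Big)a^{n-1}\,da=\infty .$$ -/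

import Mathlib

open MeasureTheory Set
open scoped ENNReal Matrix

noncomputable section

namespace EuclideanMotion

/-! ### Schatten classes -/

section Schatten

variable {H : Type*} [NormedAddCommGroup H] [InnerProductSpace ℂ H] [CompleteSpace H]

/-- The trace `∑ i, ⟪e i, A (e i)⟫ ∈ [0, ∞]` of a positive bounded operator `A`, computed in an
orthonormal basis of the Hilbert space (for positive `A` the value does not depend on the basis). -/
def posTrace (A : H →L[ℂ] H) : ℝ≥0∞ :=
  ∑' e : (exists_hilbertBasis ℂ H).choose,
    ENNReal.ofReal (RCLike.re (inner ℂ (e : H) (A (e : H))))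

/-- The Schatten norm `‖T‖_{S_q} = (tr (T* T)^{q/2})^{1/q} ∈ [0, ∞]`, where `(T* T)^{q/2}` is given
by the continuous functional calculus; it is `∞` if `T` is not in the Schatten class `S_q`. -/
def schattenNorm (q : ℝ) (T : H →L[ℂ] H) : ℝ≥0∞ :=
  posTrace ((star T * T) ^ (q / 2)) ^ (1 / q)

end Schatten

/-! ### The unitary dual of a compact group -/

section Dual

variable (G : Type) [Group G] [TopologicalSpace G]

/-- A continuous irreducible unitary representation of `G` on `ℂ^d`, `d ≥ 1`. -/
structure IrrepU where
  /-- the dimension `d` -/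
  dim : ℕ
  /-- the homomorphism into the unitary group `U(d)` -/
  hom : G →* Matrix.unitaryGroup (Fin dim) ℂ
  continuous_hom : Continuous hom
  dim_pos : 0 < dim
  irreducible : ∀ W : Submodule ℂ (Fin dim → ℂ),
    (∀ u : G, ∀ v ∈ W, (hom u : Matrix (Fin dim) (Fin dim) ℂ) *ᵥ v ∈ W) → W = ⊥ ∨ W = ⊤

variable {G}

/-- Unitary equivalence: a unitary matrix `U` with `σ(u) U = U τ(u)` for all `u`. -/
def IrrepU.Equivalent (σ τ : IrrepU G) : Prop :=
  ∃ U : Matrix (Fin σ.dim) (Fin τ.dim) ℂ, U * Uᴴ = 1 ∧ Uᴴ * U = 1 ∧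
    ∀ u : G, (σ.hom u : Matrix (Fin σ.dim) (Fin σ.dim) ℂ) * U =
      U * (τ.hom u : Matrix (Fin τ.dim) (Fin τ.dim) ℂ)

theorem IrrepU.equivalent_equivalence : Equivalence (IrrepU.Equivalent (G := G)) where
  refl σ := ⟨1, by simp, by simp, by simp⟩
  symm := by
    rintro σ τ ⟨U, h1, h2, h3⟩
    refine ⟨Uᴴ, by simpa using h2, by simpa using h1, fun u => ?_⟩
    calc _ = Uᴴ * (U * (τ.hom u).1) * Uᴴ := by
            rw [← Matrix.mul_assoc Uᴴ U, h2, Matrix.one_mul]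
      _ = Uᴴ * (σ.hom u).1 * (U * Uᴴ) := by rw [← h3]; simp only [Matrix.mul_assoc]
      _ = _ := by rw [h1, Matrix.mul_one]
  trans := by
    rintro σ τ ρ ⟨U, h1, h2, h3⟩ ⟨V, k1, k2, k3⟩
    refine ⟨U * V, ?_, ?_, fun u => ?_⟩
    · rw [Matrix.conjTranspose_mul, Matrix.mul_assoc, ← Matrix.mul_assoc V, k1, Matrix.one_mul, h1]
    · rw [Matrix.conjTranspose_mul, Matrix.mul_assoc, ← Matrix.mul_assoc Uᴴ, h2, Matrix.one_mul, k2]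
    · rw [← Matrix.mul_assoc, h3, Matrix.mul_assoc, k3, Matrix.mul_assoc]

variable (G) in
/-- Unitary equivalence as a setoid. -/
def irrepSetoid : Setoid (IrrepU G) := ⟨IrrepU.Equivalent, IrrepU.equivalent_equivalence⟩

variable (G) in
/-- The unitary dual of a compact group `G`: continuous irreducible unitary representations
(all of them finite-dimensional) up to unitary equivalence. -/
def UnitaryDual : Type := Quotient (irrepSetoid G)

/-- A representation in the given class. -/
def UnitaryDual.rep (σ : UnitaryDual G) : IrrepU G := Quotient.out σ

end Dual

/-! ### The groups `K = SO(n)` and `M = SO(n-1)` -/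

/-- `ℝ^n` with its Euclidean norm. -/
abbrev E (n : ℕ) : Type := EuclideanSpace ℝ (Fin n)

/-- `K = SO(n)`. -/
abbrev K (n : ℕ) : Type := Matrix.specialOrthogonalGroup (Fin n) ℝ

variable {n : ℕ}

instance : MeasurableSpace (K n) := borel _
instance : BorelSpace (K n) := ⟨rfl⟩

theorem K.inv_val (k : K n) : (k⁻¹).1 = (k.1)ᵀ := rfl

theorem K.mul_transpose (k : K n) : k.1 * (k.1)ᵀ = 1 :=
  (Matrix.mem_orthogonalGroup_iff _ _).1 (Matrix.mem_specialOrthogonalGroup_iff.1 k.2).1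

instance : IsTopologicalGroup (K n) where
  continuous_mul := by
    refine Continuous.subtype_mk ?_ _
    exact (continuous_subtype_val.comp continuous_fst).mul (continuous_subtype_val.comp continuous_snd)
  continuous_inv := by
    refine continuous_induced_rng.2 ?_
    exact Continuous.matrix_transpose continuous_subtype_val

instance : SecondCountableTopology (K n) :=
  haveI : SecondCountableTopology (Matrix (Fin n) (Fin n) ℝ) :=
    inferInstanceAs (SecondCountableTopology (Fin n → Fin n → ℝ))
  TopologicalSpace.Subtype.secondCountableTopology _

instance : CompactSpace (K n) := by
  refine isCompact_iff_compactSpace.1 ?_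
  refine IsCompact.of_isClosed_subset (s := Set.pi univ fun _ : Fin n =>
    Set.pi univ fun _ : Fin n => Icc (-1 : ℝ) 1) ?_ ?_ ?_
  · exact isCompact_univ_pi fun _ => isCompact_univ_pi fun _ => isCompact_Icc
  · have : ((Matrix.specialOrthogonalGroup (Fin n) ℝ : Set (Matrix (Fin n) (Fin n) ℝ))) =
        {A | A * Aᵀ = 1} ∩ {A | A.det = 1} := by
      ext A
      exact Matrix.mem_specialOrthogonalGroup_iff.trans
        (and_congr_left' (Matrix.mem_orthogonalGroup_iff _ _))
    rw [this]
    exact (isClosed_eq (continuous_id.mul (Continuous.matrix_transpose continuous_id))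
      continuous_const).inter (isClosed_eq (Continuous.matrix_det continuous_id) continuous_const)
  · intro A hA i _ j _
    have h : ∑ j, A i j * A i j = 1 :=
      (congrFun (congrFun (K.mul_transpose ⟨A, hA⟩) i) i).trans (Matrix.one_apply_eq i)
    have h2 : A i j * A i j ≤ 1 := by
      rw [← h]
      exact Finset.single_le_sum (f := fun j => A i j * A i j)
        (fun j _ => mul_self_nonneg (A i j)) (Finset.mem_univ j)
    exact ⟨by nlinarith, by nlinarith⟩

/-- The action `k · x` of `SO(n)` on `ℝ^n`. -/
def act (k : K n) (x : E n) : E n := WithLp.toLp 2 (k.1 *ᵥ x.ofLp)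

theorem act_one (x : E n) : act 1 x = x := by
  simp [act]

theorem act_mul (k l : K n) (x : E n) : act (k * l) x = act k (act l x) := by
  simp [act, Matrix.mulVec_mulVec]

theorem continuous_act (x : E n) : Continuous fun k : K n => act k x := by
  refine (PiLp.continuous_toLp 2 _).comp ?_
  exact Continuous.matrix_mulVec continuous_subtype_val continuous_const

/-- The unit vector `e₁ = (1, 0, …, 0)`. -/
def e₁ (n : ℕ) : E n := WithLp.toLp 2 fun i => if (i : ℕ) = 0 then 1 else 0

/-- `M`, the subgroup of `SO(n)` that fixes `e₁` (a copy of `SO(n-1)`). -/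
def M (n : ℕ) : Subgroup (K n) where
  carrier := {k | act k (e₁ n) = e₁ n}
  one_mem' := act_one _
  mul_mem' {k l} hk hl := by
    simp only [mem_ofPred_eq] at *
    rw [act_mul, hl, hk]
  inv_mem' {k} hk := by
    simp only [mem_ofPred_eq] at *
    conv_lhs => rw [← hk]
    rw [← act_mul, inv_mul_cancel, act_one]

/-- The normalised Haar measure `dk` of `SO(n)`. -/
def haarK (n : ℕ) : Measure (K n) := Measure.haarMeasure ⊤

instance : (haarK n).IsHaarMeasure := by unfold haarK; infer_instance
instance : IsProbabilityMeasure (haarK n) := ⟨by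
  simpa [haarK] using Measure.haarMeasure_self (K₀ := (⊤ : TopologicalSpace.PositiveCompacts (K n)))⟩
instance : (haarK n).IsMulRightInvariant := ⟨fun g => by
  have : IsProbabilityMeasure (Measure.map (· * g) (haarK n)) :=
    Measure.isProbabilityMeasure_map (measurable_mul_const g).aemeasurable
  exact Measure.isHaarMeasure_eq_of_isProbabilityMeasure _ _⟩

/-- The underlying space `ℝ^n × SO(n)` of the Euclidean motion group `M(n)`, whose group law is
`(x₁, k₁) (x₂, k₂) = (x₁ + k₁ · x₂, k₁ k₂)`. -/
abbrev Motion (n : ℕ) : Type := E n × K n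

/-- The Haar measure `dν(x, k) = dx dk` of `M(n)`. -/
def haarMotion (n : ℕ) : Measure (Motion n) := (volume : Measure (E n)).prod (haarK n)

/-! ### The representations `π_{a,σ}` -/

/-- `ℂ^{d×d}` with the inner product `tr (X* Y)`. -/
abbrev Mat (d : ℕ) : Type := EuclideanSpace ℂ (Fin d × Fin d)

/-- Left multiplication `X ↦ A X` on `ℂ^{d×d}`. -/
def leftMul {d : ℕ} (A : Matrix (Fin d) (Fin d) ℂ) : Mat d →L[ℂ] Mat d :=
  LinearMap.toContinuousLinearMap
    { toFun := fun X => WithLp.toLp 2 fun p => ∑ l, A p.1 l * X (l, p.2)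
      map_add' := fun X Y => by
        ext p; simp [mul_add, Finset.sum_add_distrib]
      map_smul' := fun c X => by
        ext p; simp [Finset.mul_sum, mul_left_comm] }

/-- `L²(K, ℂ^{d×d})`, without the covariance condition. -/
abbrev L2 (n d : ℕ) : Type := Lp (Mat d) 2 (haarK n)

/-- The space `L²(K, ℂ^{d×d}; σ)` of all `φ` in `L²(K, ℂ^{d×d})` such that
`φ(uk) = σ(u) φ(k)` for `u ∈ M`, `k ∈ K`. -/
def Hsp (σ : IrrepU (M n)) : Submodule ℂ (L2 n σ.dim) where
  carrier := {φ | ∀ u : M n, ∀ᵐ k ∂haarK n, φ (u.1 * k) = leftMul (σ.hom u).1 (φ k)}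
  zero_mem' := fun u => by
    have h := Lp.coeFn_zero (Mat σ.dim) 2 (haarK n)
    filter_upwards [h, (quasiMeasurePreserving_mul_left (haarK n) u.1).ae h] with k h1 h2
    rw [h1, h2]; simp
  add_mem' := fun {φ ψ} hφ hψ u => by
    have h := Lp.coeFn_add φ ψ
    filter_upwards [h, (quasiMeasurePreserving_mul_left (haarK n) u.1).ae h, hφ u, hψ u]
      with k h1 h2 h3 h4
    rw [h1, h2, Pi.add_apply, Pi.add_apply, map_add, h3, h4]
  smul_mem' := fun c φ hφ u => by
    have h := Lp.coeFn_smul c φ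
    filter_upwards [h, (quasiMeasurePreserving_mul_left (haarK n) u.1).ae h, hφ u] with k h1 h2 h3
    rw [h1, h2, Pi.smul_apply, Pi.smul_apply, map_smul, h3]

theorem isClosed_Hsp (σ : IrrepU (M n)) : IsClosed (Hsp σ : Set (L2 n σ.dim)) := by
  have : (Hsp σ : Set (L2 n σ.dim)) = ⋂ u : M n,
      {φ | Lp.compMeasurePreservingₗᵢ ℂ (u.1 * ·) (measurePreserving_mul_left (haarK n) u.1) φ =
        (leftMul (σ.hom u).1).compLpL 2 (haarK n) φ} := by
    ext φ
    simp only [mem_iInter, mem_ofPred_eq]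
    refine forall_congr' fun u => ?_
    have h1 : (Lp.compMeasurePreservingₗᵢ ℂ (u.1 * ·)
        (measurePreserving_mul_left (haarK n) u.1) φ : K n → Mat σ.dim) =ᵐ[haarK n]
          fun k => φ (u.1 * k) :=
      Lp.coeFn_compMeasurePreserving φ (measurePreserving_mul_left (haarK n) u.1)
    have h2 := (leftMul (σ.hom u).1).coeFn_compLpL φ (p := 2) (μ := haarK n)
    rw [Lp.ext_iff]
    constructor
    · intro h
      filter_upwards [h, h1, h2] with k h h1 h2
      rw [h1, h2, h]
    · intro h
      filter_upwards [h, h1, h2] with k h h1 h2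
      rw [← h1, ← h2, h]
  rw [this]
  exact isClosed_iInter fun u => isClosed_eq (LinearIsometry.continuous _)
    (ContinuousLinearMap.continuous _)

instance (σ : IrrepU (M n)) : CompleteSpace (Hsp σ) := (isClosed_Hsp σ).completeSpace_coe

/-- The function `s ↦ e^{i a ⟨s⁻¹ · e₁, x⟩}` on `K`. -/
def phase (a : ℝ) (x : E n) : C(K n, ℂ) where
  toFun s := Complex.exp (Complex.I * (a * inner ℝ (act s⁻¹ (e₁ n)) x : ℝ))
  continuous_toFun := by
    have : Continuous fun s : K n => act s⁻¹ (e₁ n) := (continuous_act _).comp continuous_inv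
    fun_prop

theorem norm_phase (a : ℝ) (x : E n) : ‖phase a x‖ ≤ 1 := by
  refine (ContinuousMap.norm_le _ zero_le_one).2 fun s => ?_
  rw [phase, ContinuousMap.coe_mk, mul_comm, Complex.norm_exp_ofReal_mul_I]

theorem continuous_phase (a : ℝ) : Continuous (phase a : E n → C(K n, ℂ)) := by
  refine ContinuousMap.continuous_of_continuous_uncurry _ ?_
  have : Continuous fun p : E n × K n => act p.2⁻¹ (e₁ n) :=
    (continuous_act _).comp continuous_snd.inv
  have h : Continuous fun p : E n × K n =>
      Complex.exp (Complex.I * (a * inner ℝ (act p.2⁻¹ (e₁ n)) p.1 : ℝ)) := by fun_prop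
  exact h

theorem phase_mul (a : ℝ) (x : E n) (u : M n) (s : K n) : phase a x (u.1 * s) = phase a x s := by
  have : act u.1⁻¹ (e₁ n) = e₁ n := (M n).inv_mem u.2
  simp only [phase, ContinuousMap.coe_mk, mul_inv_rev, act_mul, this]

/-- The operator `φ ↦ (s ↦ e^{i a ⟨s⁻¹ · e₁, x⟩} φ(s k))` on `L²(K, ℂ^{d×d})`. -/
def piL2 (d : ℕ) (a : ℝ) (g : Motion n) : L2 n d →L[ℂ] L2 n d :=
  (ContinuousLinearMap.lsmul ℂ ℂ : ℂ →L[ℂ] Mat d →L[ℂ] Mat d).holderL (haarK n) ∞ 2 2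
      (ContinuousMap.toLp ∞ (haarK n) ℂ (phase a g.1)) ∘L
    (Lp.compMeasurePreservingₗᵢ ℂ (· * g.2)
      (measurePreserving_mul_right (haarK n) g.2)).toContinuousLinearMap

theorem piL2_apply (d : ℕ) (a : ℝ) (g : Motion n) (φ : L2 n d) :
    ∀ᵐ s ∂haarK n, piL2 d a g φ s = phase a g.1 s • φ (s * g.2) := by
  have h1 := ContinuousLinearMap.coeFn_holder
    (ContinuousLinearMap.lsmul ℂ ℂ : ℂ →L[ℂ] Mat d →L[ℂ] Mat d) (r := 2)
    (ContinuousMap.toLp ∞ (haarK n) ℂ (phase a g.1))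
    (Lp.compMeasurePreserving (· * g.2) (measurePreserving_mul_right (haarK n) g.2) φ)
  have h2 := Lp.coeFn_compMeasurePreserving φ (measurePreserving_mul_right (haarK n) g.2)
  have h3 := ContinuousMap.coeFn_toLp (p := ∞) (haarK n) (𝕜 := ℂ) (phase a g.1)
  filter_upwards [h1, h2, h3] with s h1 h2 h3
  refine h1.trans ?_
  rw [h2, h3]; rfl

theorem norm_piL2_apply_le (d : ℕ) (a : ℝ) (g : Motion n) (φ : L2 n d) :
    ‖piL2 d a g φ‖ ≤ ‖φ‖ := by
  refine Lp.norm_le_norm_of_ae_le (g := Lp.compMeasurePreserving (· * g.2)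
    (measurePreserving_mul_right (haarK n) g.2) φ) ?_ |>.trans
    (Lp.norm_compMeasurePreserving _ _).le
  filter_upwards [piL2_apply d a g φ, Lp.coeFn_compMeasurePreserving φ
    (measurePreserving_mul_right (haarK n) g.2)] with s h1 h2
  rw [h1, h2, norm_smul, Function.comp_apply]
  exact mul_le_of_le_one_left (norm_nonneg _)
    (((phase a g.1).norm_coe_le_norm s).trans (norm_phase a g.1))

theorem continuous_piL2_apply (d : ℕ) (a : ℝ) (φ : L2 n d) :
    Continuous fun g : Motion n => piL2 d a g φ := by
  have h1 : Continuous fun g : Motion n => ContinuousMap.toLp ∞ (haarK n) ℂ (phase a g.1) :=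
    (ContinuousLinearMap.continuous _).comp ((continuous_phase a).comp continuous_fst)
  have h2 : Continuous fun g : Motion n => Lp.compMeasurePreserving (· * g.2)
      (measurePreserving_mul_right (haarK n) g.2) φ := by
    refine Continuous.compMeasurePreservingLp (f := fun _ : Motion n => φ)
      (g := fun g : Motion n => (⟨(· * g.2), continuous_mul_const g.2⟩ : C(K n, K n)))
      continuous_const ?_ (fun g => measurePreserving_mul_right (haarK n) g.2) (by simp)
    refine ContinuousMap.continuous_of_continuous_uncurry _ ?_
    exact continuous_snd.mul (continuous_snd.comp continuous_fst)
  exact (((ContinuousLinearMap.lsmul ℂ ℂ : ℂ →L[ℂ] Mat d →L[ℂ] Mat d).holderL (haarK n) ∞ 2 2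
    ).continuous.comp h1).clm_apply h2

theorem piL2_mem (σ : IrrepU (M n)) (a : ℝ) (g : Motion n) {φ : L2 n σ.dim} (hφ : φ ∈ Hsp σ) :
    piL2 σ.dim a g φ ∈ Hsp σ := fun u => by
  have h := piL2_apply σ.dim a g φ
  filter_upwards [h, (quasiMeasurePreserving_mul_left (haarK n) u.1).ae h,
    (quasiMeasurePreserving_mul_right (haarK n) g.2).ae (hφ u)] with s h1 h2 h3
  rw [h1, h2, phase_mul, mul_assoc, h3, map_smul]

/-- The operator `π_{a,σ}(x,k)` on `L²(K, ℂ^{d×d}; σ)`: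
`(π_{a,σ}(x,k) φ)(s) = e^{i a ⟨s⁻¹ · e₁, x⟩} φ(s k)`. -/
def rep (σ : IrrepU (M n)) (a : ℝ) (g : Motion n) : Hsp σ →L[ℂ] Hsp σ :=
  (piL2 σ.dim a g ∘L (Hsp σ).subtypeL).codRestrict (Hsp σ) fun φ => piL2_mem σ a g φ.2

theorem norm_rep_apply_le (σ : IrrepU (M n)) (a : ℝ) (g : Motion n) (φ : Hsp σ) :
    ‖rep σ a g φ‖ ≤ ‖φ‖ :=
  norm_piL2_apply_le σ.dim a g φ.1

theorem continuous_rep_apply (σ : IrrepU (M n)) (a : ℝ) (φ : Hsp σ) :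
    Continuous fun g : Motion n => rep σ a g φ :=
  (continuous_piL2_apply σ.dim a φ.1).subtype_mk _

/-! ### The group Fourier transform -/

theorem integrable_smul_rep {f : Motion n → ℂ} (hf : Integrable f (haarMotion n))
    (σ : IrrepU (M n)) (a : ℝ) (φ : Hsp σ) :
    Integrable (fun g => f g • rep σ a g φ) (haarMotion n) := by
  refine (hf.norm.mul_const ‖φ‖).mono'
    (hf.aestronglyMeasurable.smul (continuous_rep_apply σ a φ).aestronglyMeasurable) ?_
  refine Filter.Eventually.of_forall fun g => ?_
  rw [norm_smul]
  exact mul_le_mul_of_nonneg_left (norm_rep_apply_le σ a g φ) (norm_nonneg _)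

open Classical in
/-- The group Fourier transform `f̂(a,σ) = ∫ f(x,k) π_{a,σ}(x,k) dx dk` of `f ∈ L¹(M(n))`, where
the operator-valued integral is taken in the strong sense: `f̂(a,σ) φ = ∫ f(g) π_{a,σ}(g) φ dν(g)`
for all `φ`. (Not meaningful, and set to `0`, if `f` is not integrable.) -/
def fourier (f : Motion n → ℂ) (a : ℝ) (σ : IrrepU (M n)) : Hsp σ →L[ℂ] Hsp σ :=
  if hf : Integrable f (haarMotion n) then
    LinearMap.mkContinuous
      { toFun := fun φ => ∫ g, f g • rep σ a g φ ∂haarMotion n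
        map_add' := fun φ ψ => by
          simp only [map_add, smul_add]
          exact integral_add (integrable_smul_rep hf σ a φ) (integrable_smul_rep hf σ a ψ)
        map_smul' := fun c φ => by
          simp only [map_smul, RingHom.id_apply, smul_comm _ c]
          exact integral_smul c _ }
      (∫ g, ‖f g‖ ∂haarMotion n) fun φ => by
        refine (norm_integral_le_of_norm_le (hf.norm.mul_const ‖φ‖)
          (Filter.Eventually.of_forall fun g => ?_)).trans (integral_mul_const _ _).le
        rw [norm_smul]
        exact mul_le_mul_of_nonneg_left (norm_rep_apply_le σ a g φ) (norm_nonneg _)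
  else 0

theorem fourier_apply {f : Motion n → ℂ} (hf : Integrable f (haarMotion n)) (a : ℝ)
    (σ : IrrepU (M n)) (φ : Hsp σ) :
    fourier f a σ φ = ∫ g, f g • rep σ a g φ ∂haarMotion n := by
  simp [fourier, hf]

/-- The function `f_β(x,k) = χ_{B_1(0)}(x) |x|^{-β}` on `M(n)`. -/
def fBeta (n : ℕ) (β : ℝ) (g : Motion n) : ℂ :=
  (Metric.ball (0 : E n) 1).indicator (fun x => ((1 / ‖x‖ ^ β : ℝ) : ℂ)) g.1

end EuclideanMotion

end

/-! Since `fBeta` does not depend on `k`, its group Fourier transform is a scalar times the average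
of right translations: the scalar `F(a)` is the Euclidean Fourier transform of `|x|^{-β}` cut off to
the unit ball, at radius `a / 2π` (`inner_fourier_fBeta`). For trivial `σ` a constant function is an
eigenvector of this operator and of its adjoint, so that class alone contributes at least `|F(a)|^q`
(`le_schattenNorm_fourier_fBeta`).

In polar coordinates, the integral of `|F(a)|^q a^{n-1}` is, up to a constant, the `q`-th power of
the `L^q(ℝ^n)` norm of the Euclidean transform. This norm is infinite once `β > n(1 - 1/q)`
(`not_integrable_fourier_ballPow`). Otherwise, pair the function with a Gaussian of width `r`: the
pairing is at least `c r^{n-β}`, while Hölder on the Fourier side bounds it by `C r^{n-n/p}`, where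
`1/p = 1 - 1/q`; letting `r → 0` contradicts this. As `q < 2`, the threshold `n(1 - 1/q)` lies below
`n/2`, which leaves room for `β`. -/

namespace EuclideanMotion

/-! ### Schatten norms and eigenvectors -/

section SchattenLowerBound

variable {H : Type*} [NormedAddCommGroup H] [InnerProductSpace ℂ H] [CompleteSpace H]

/-- If `v` is an eigenvector of a positive operator `A` with eigenvalue `t > 0`, then it is an
eigenvector of `A ^ p` with eigenvalue `t ^ p`. -/
theorem rpow_apply_of_eigenvector {A : H →L[ℂ] H} (hA : 0 ≤ A) {t p : ℝ} (ht : 0 < t) (hp : 0 ≤ p)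
    {v : H} (hv : A v = (t : ℂ) • v) : (A ^ p) v = ((t ^ p : ℝ) : ℂ) • v := by
  have hsa : IsSelfAdjoint A := .of_nonneg hA
  have hc : Continuous fun x : ℝ => x ^ p := Real.continuous_rpow_const hp
  -- The quotient `(x^p - t^p)/(x - t)` extends continuously to `x = t` because `t > 0`. The
  -- functional calculus then factors `A^p - t^p` through `A - t`, which kills `v`.
  have hd : Continuous (dslope (fun x : ℝ => x ^ p) t) := by
    rw [← continuousOn_univ, continuousOn_dslope Filter.univ_mem]
    exact ⟨hc.continuousOn, (Real.hasDerivAt_rpow_const (Or.inl ht.ne')).differentiableAt⟩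
  have key : A ^ p = algebraMap ℝ (H →L[ℂ] H) (t ^ p) +
      cfc (dslope (fun x : ℝ => x ^ p) t) A * (A - algebraMap ℝ (H →L[ℂ] H) t) := by
    have h1 : (fun x : ℝ => x ^ p) =
        fun x => t ^ p + dslope (fun x : ℝ => x ^ p) t x * (x - t) := by
      funext x
      have := sub_smul_dslope (fun x : ℝ => x ^ p) t x
      rw [smul_eq_mul] at this
      linarith
    rw [CFC.rpow_eq_cfc_real hA]
    conv_lhs => rw [h1]
    rw [cfc_const_add (t ^ p) _ A (by fun_prop) hsa, cfc_mul _ _ A (by fun_prop) (by fun_prop),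
      cfc_sub _ _ A (by fun_prop) (by fun_prop), cfc_const t A hsa, cfc_id' ℝ A hsa]
  have h0 : (A - algebraMap ℝ (H →L[ℂ] H) t) v = 0 := by
    rw [sub_apply, hv, Algebra.algebraMap_eq_smul_one]
    simp
  rw [key, add_apply, mul_apply_eq_comp, h0, map_zero, add_zero, Algebra.algebraMap_eq_smul_one]
  simp

/-- With `B = √A`, Parseval gives `⟪v, A v⟫ = ‖B v‖² = ∑ |⟪v, B bᵢ⟫|²`, and by Cauchy–Schwarz each
term is at most `‖B bᵢ‖² = ⟪bᵢ, A bᵢ⟫`. -/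
theorem le_posTrace {A : H →L[ℂ] H} (hA : 0 ≤ A) {v : H} (hv : ‖v‖ = 1) :
    ENNReal.ofReal (RCLike.re (inner ℂ v (A v))) ≤ posTrace A := by
  set B := CFC.sqrt A with hB
  have hBs : IsSelfAdjoint B := .of_nonneg (CFC.sqrt_nonneg A)
  have hin : ∀ x : H, inner ℂ x (A x) = ((‖B x‖ ^ 2 : ℝ) : ℂ) := fun x => by
    rw [← CFC.sqrt_mul_sqrt_self A hA, mul_apply_eq_comp, ← hB,
      ← ContinuousLinearMap.adjoint_inner_left, hBs.adjoint_eq, inner_self_eq_norm_sq_to_K]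
    simp
  obtain ⟨b, hb⟩ := (exists_hilbertBasis ℂ H).choose_spec
  have hsum := (Complex.hasSum_re (b.hasSum_inner_mul_inner (B v) (B v)))
  have hterm : ∀ i, (inner ℂ (B v) (b i) * inner ℂ (b i) (B v)).re ≤
      RCLike.re (inner ℂ (b i) (A (b i))) := fun i => by
    have h1 : inner ℂ (B v) (b i) = inner ℂ v (B (b i)) := by
      rw [← ContinuousLinearMap.adjoint_inner_right, hBs.adjoint_eq]
    rw [← inner_conj_symm (b i) (B v), Complex.mul_conj, h1, hin]
    have h2 : ‖inner ℂ v (B (b i))‖ ≤ ‖B (b i)‖ := by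
      simpa [hv] using norm_inner_le_norm (𝕜 := ℂ) v (B (b i))
    rw [Complex.normSq_eq_norm_sq]
    exact_mod_cast pow_le_pow_left₀ (norm_nonneg _) h2 2
  have hnn : ∀ i, 0 ≤ (inner ℂ (B v) (b i) * inner ℂ (b i) (B v)).re := fun i => by
    rw [← inner_conj_symm (b i) (B v), Complex.mul_conj, Complex.ofReal_re]
    exact Complex.normSq_nonneg _
  calc ENNReal.ofReal (RCLike.re (inner ℂ v (A v)))
      = ENNReal.ofReal (∑' i, (inner ℂ (B v) (b i) * inner ℂ (b i) (B v)).re) := by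
        rw [hsum.tsum_eq, hin, inner_self_eq_norm_sq_to_K]
        norm_cast
    _ = ∑' i, ENNReal.ofReal (inner ℂ (B v) (b i) * inner ℂ (b i) (B v)).re :=
        ENNReal.ofReal_tsum_of_nonneg hnn hsum.summable
    _ ≤ posTrace A := by
        refine ENNReal.tsum_le_tsum fun i => ENNReal.ofReal_le_ofReal ?_
        have := hterm i
        rwa [congrFun hb i] at this ⊢

/-- A common eigenvector of `T` and its adjoint bounds the Schatten norms of `T` from below. -/
theorem le_schattenNorm_rpow {T : H →L[ℂ] H} {q : ℝ} (hq : 0 < q) {c : ℂ} {v : H} (hv : ‖v‖ = 1)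
    (hT : T v = c • v) (hT' : ∀ φ, inner ℂ v (T φ) = c * inner ℂ v φ) :
    ENNReal.ofReal (‖c‖ ^ q) ≤ schattenNorm q T ^ q := by
  rw [schattenNorm, ← ENNReal.rpow_mul, one_div_mul_cancel hq.ne', ENNReal.rpow_one]
  rcases eq_or_ne c 0 with rfl | hc
  · simp [Real.zero_rpow hq.ne']
  have hA : (0 : H →L[ℂ] H) ≤ star T * T := star_mul_self_nonneg T
  -- `hT'` is the weak form of `T* v = conj c • v`.
  have hAv : (star T * T) v = ((‖c‖ ^ 2 : ℝ) : ℂ) • v := by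
    refine ext_inner_right ℂ fun φ => ?_
    rw [mul_apply_eq_comp, ContinuousLinearMap.star_eq_adjoint,
      ContinuousLinearMap.adjoint_inner_left, hT, inner_smul_left, inner_smul_left, hT',
      ← mul_assoc, mul_comm _ c, Complex.mul_conj, Complex.normSq_eq_norm_sq, Complex.conj_ofReal]
  have h := rpow_apply_of_eigenvector hA (p := q / 2) (by positivity) (by positivity) hAv
  have h2 : (‖c‖ ^ 2) ^ (q / 2) = ‖c‖ ^ q := by
    rw [← Real.rpow_natCast, ← Real.rpow_mul (norm_nonneg c)]
    congr 1
    push_cast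
    ring
  rw [h2] at h
  refine le_trans (le_of_eq ?_) (le_posTrace CFC.rpow_nonneg hv)
  rw [h, inner_smul_right, inner_self_eq_norm_sq_to_K, hv]
  simp

end SchattenLowerBound

/-! ### Integrability and support of the truncated power -/

section BallFunction

variable {n : ℕ}

/-- The function `χ_{B_1(0)}(x) |x|^{-β}` on `ℝ^n`. -/
noncomputable def ballPow (n : ℕ) (β : ℝ) : E n → ℂ :=
  (Metric.ball (0 : E n) 1).indicator fun x => ((1 / ‖x‖ ^ β : ℝ) : ℂ)

theorem measurable_ballPow (β : ℝ) : Measurable (ballPow n β) :=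
  Measurable.indicator (by fun_prop) measurableSet_ball

theorem integrable_ballPow (hn : 1 ≤ n) {β : ℝ} (hβ : β < n) : Integrable (ballPow n β) := by
  rw [ballPow, integrable_indicator_iff measurableSet_ball]
  refine integrableOn_ball_of_norm_le_rpow (C := 1) (α := β) (by simpa using hn)
    (by simpa using hβ) ?_ (by fun_prop : Measurable _).aestronglyMeasurable
  refine Filter.Eventually.of_forall fun x => ?_
  rw [Complex.norm_real, Real.norm_of_nonneg (by positivity), Real.rpow_neg (norm_nonneg x)]
  simp

/-- Reduces square integrability for `β` to integrability for `2β < n`. -/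
theorem norm_ballPow_sq (β : ℝ) (x : E n) : ‖ballPow n β x‖ ^ 2 = ‖ballPow n (2 * β) x‖ := by
  by_cases hx : x ∈ Metric.ball (0 : E n) 1
  · simp only [ballPow, indicator_of_mem hx, Complex.norm_real, one_div, norm_inv, inv_pow]
    rw [Real.norm_of_nonneg (by positivity), Real.norm_of_nonneg (by positivity), mul_comm,
      Real.rpow_mul (norm_nonneg x), Real.rpow_two]
  · simp [ballPow, indicator_of_notMem hx]

theorem integrable_fBeta (hn : 1 ≤ n) {β : ℝ} (hβ : β < n) :
    Integrable (fBeta n β) (haarMotion n) :=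
  (integrable_ballPow hn hβ).comp_fst (haarK n)

theorem memLp_two_fBeta (hn : 1 ≤ n) {β : ℝ} (hβ : β < n / 2) :
    MemLp (fBeta n β) 2 (haarMotion n) := by
  have hm : AEStronglyMeasurable (fBeta n β) (haarMotion n) :=
    ((measurable_ballPow β).comp measurable_fst).aestronglyMeasurable
  rw [memLp_two_iff_integrable_sq_norm hm]
  refine ((integrable_fBeta hn (β := 2 * β) (by linarith)).norm).congr
    (Filter.Eventually.of_forall fun g => ?_)
  exact (norm_ballPow_sq β g.1).symm

theorem hasCompactSupport_fBeta (β : ℝ) : HasCompactSupport (fBeta n β) := by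
  refine HasCompactSupport.intro ((isCompact_closedBall (0 : E n) 1).prod isCompact_univ)
    fun g hg => ?_
  refine indicator_of_notMem (fun h => hg ⟨Metric.ball_subset_closedBall h, mem_univ _⟩) _

end BallFunction

/-! ### The Euclidean Fourier transform of the truncated power -/

section RadialFourier

open scoped FourierTransform Topology

variable {n : ℕ}

/-- Nonnegativity means that no cancellation occurs when pairing with a Gaussian. -/
theorem ballPow_eq_norm (β : ℝ) (x : E n) : ballPow n β x = (‖ballPow n β x‖ : ℂ) := by
  by_cases hx : x ∈ Metric.ball (0 : E n) 1
  · simp only [ballPow, indicator_of_mem hx, Complex.norm_real]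
    rw [Real.norm_of_nonneg (by positivity)]
  · simp [ballPow, indicator_of_notMem hx]

theorem ballPow_comp_isometry (β : ℝ) (A : E n ≃ₗᵢ[ℝ] E n) :
    ballPow n β ∘ A = ballPow n β := by
  funext x
  simp [ballPow, indicator]

/-- The Fourier transform of the radial function `ballPow` is radial. -/
theorem fourier_ballPow_eq_of_norm_eq (β : ℝ) {w w' : E n} (h : ‖w‖ = ‖w'‖) :
    𝓕 (ballPow n β) w = 𝓕 (ballPow n β) w' := by
  -- The reflection in the hyperplane orthogonal to `w - w'` maps `w` to `w'`.
  have := Real.fourier_comp_linearIsometry ((ℝ ∙ (w - w'))ᗮ.reflection) (ballPow n β) w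
  rwa [ballPow_comp_isometry, Submodule.reflection_sub h] at this

theorem continuous_fourier_ballPow (hn : 1 ≤ n) {β : ℝ} (hβ : β < n) :
    Continuous (𝓕 (ballPow n β)) :=
  VectorFourier.fourierIntegral_continuous Real.continuous_fourierChar continuous_inner
    (integrable_ballPow hn hβ)

/-- Pairing `|x|^{-β}` with a Gaussian of width `r`. -/
theorem le_integral_ballPow_gaussian (hn : 1 ≤ n) {β r : ℝ} (h0 : 0 ≤ β) (hβ : β < n)
    (hr : 0 < r) (hr1 : r ≤ 1) :
    Real.exp (-Real.pi) * volume.real (Metric.ball (0 : E n) 1) * r ^ (n - β) ≤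
      ∫ x, ‖ballPow n β x‖ * Real.exp (-(Real.pi / r ^ 2) * ‖x‖ ^ 2) := by
  have : Nonempty (Fin n) := ⟨⟨0, hn⟩⟩
  have hint : Integrable fun x : E n =>
      ‖ballPow n β x‖ * Real.exp (-(Real.pi / r ^ 2) * ‖x‖ ^ 2) := by
    refine (integrable_ballPow hn hβ).norm.mul_bdd (c := 1)
      (by fun_prop : Measurable _).aestronglyMeasurable (Filter.Eventually.of_forall fun x => ?_)
    rw [Real.norm_of_nonneg (Real.exp_nonneg _), Real.exp_le_one_iff, neg_mul]
    exact neg_nonpos.2 (by positivity)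
  have hvol : volume.real (Metric.ball (0 : E n) r) =
      r ^ n * volume.real (Metric.ball (0 : E n) 1) := by
    rw [Measure.real, Measure.addHaar_ball_of_pos volume 0 hr, ENNReal.toReal_mul,
      ENNReal.toReal_ofReal (by positivity), Measure.real, finrank_euclideanSpace_fin]
  -- Only the ball of radius `r` is kept: there the power is at least `r^{-β}` and the Gaussian at
  -- least `e^{-π}`.
  calc Real.exp (-Real.pi) * volume.real (Metric.ball (0 : E n) 1) * r ^ (n - β)
      = ∫ x in Metric.ball (0 : E n) r, r ^ (-β) * Real.exp (-Real.pi) := by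
        rw [setIntegral_const, hvol, Real.rpow_sub hr, Real.rpow_natCast, Real.rpow_neg hr.le,
          smul_eq_mul]
        ring
    _ ≤ ∫ x in Metric.ball (0 : E n) r,
          ‖ballPow n β x‖ * Real.exp (-(Real.pi / r ^ 2) * ‖x‖ ^ 2) := by
        refine setIntegral_mono_on_ae (integrableOn_const measure_ball_lt_top.ne) hint.integrableOn
          measurableSet_ball ?_
        -- The origin is discarded: for `β > 0` the convention `1 / 0 = 0` makes the integrand
        -- vanish there.
        filter_upwards [measure_eq_zero_iff_ae_notMem.1 (measure_singleton (0 : E n))]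
          with x hx0 hx
        have hxr : ‖x‖ < r := by simpa using hx
        have hx0 : 0 < ‖x‖ := norm_pos_iff.2 hx0
        have hx1 : x ∈ Metric.ball (0 : E n) 1 := by simpa using hxr.trans_le hr1
        simp only [ballPow, indicator_of_mem hx1, Complex.norm_real]
        rw [Real.norm_of_nonneg (by positivity), Real.rpow_neg hr.le, one_div]
        have h1 : ‖x‖ ^ β ≤ r ^ β := Real.rpow_le_rpow hx0.le hxr.le h0
        have h2 : Real.pi / r ^ 2 * ‖x‖ ^ 2 ≤ Real.pi := by
          rw [div_mul_eq_mul_div, div_le_iff₀ (by positivity)]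
          gcongr
        gcongr
        linarith
    _ ≤ _ := setIntegral_le_integral hint (Filter.Eventually.of_forall fun x => by positivity)

/-- The Gaussian on the left is the transform of `r^n e^{-π r² |ξ|²}`, so the multiplication formula
`∫ f ĝ = ∫ f̂ g` moves the transform onto `ballPow`; the triangle inequality does the rest. -/
theorem integral_ballPow_gaussian_le (hn : 1 ≤ n) {β r : ℝ} (hβ : β < n) (hr : 0 < r) :
    ∫ x, ‖ballPow n β x‖ * Real.exp (-(Real.pi / r ^ 2) * ‖x‖ ^ 2) ≤
      ∫ ξ, ‖𝓕 (ballPow n β) ξ‖ * (r ^ n * Real.exp (-(Real.pi * r ^ 2) * ‖ξ‖ ^ 2)) := by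
  set b : ℂ := ((Real.pi * r ^ 2 : ℝ) : ℂ) with hb
  have hbre : 0 < b.re := by rw [hb, Complex.ofReal_re]; positivity
  have hgi : Integrable fun v : E n => Complex.exp (-b * ‖v‖ ^ 2) := by
    simpa using GaussianFourier.integrable_cexp_neg_mul_sq_norm_add hbre 0 (0 : E n)
  have hg : ∀ w : E n, (r : ℂ) ^ n * 𝓕 (fun v : E n => Complex.exp (-b * ‖v‖ ^ 2)) w =
      (Real.exp (-(Real.pi / r ^ 2) * ‖w‖ ^ 2) : ℂ) := fun w => by
    have h1 : (Real.pi : ℂ) / b = (((r ^ 2)⁻¹ : ℝ) : ℂ) := by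
      rw [hb]
      push_cast
      field_simp
    have h2 : ((Real.pi : ℂ) / b) ^ ((n : ℂ) / 2) = ((r : ℂ) ^ n)⁻¹ := by
      rw [h1, show (n : ℂ) / 2 = ((n / 2 : ℝ) : ℂ) by push_cast; ring,
        ← Complex.ofReal_cpow (by positivity), Real.inv_rpow (by positivity), ← Real.rpow_natCast r 2,
        ← Real.rpow_mul hr.le]
      push_cast
      rw [mul_div_cancel₀ _ (two_ne_zero' ℝ), Real.rpow_natCast]
      push_cast
      rfl
    rw [fourier_gaussian_innerProductSpace hbre, finrank_euclideanSpace_fin, h2,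
      ← mul_assoc, mul_inv_cancel₀ (by simp [hr.ne']), one_mul, Complex.ofReal_exp, hb]
    congr 1
    push_cast
    field_simp
  have hflip : ∫ ξ, 𝓕 (ballPow n β) ξ • Complex.exp (-b * ‖ξ‖ ^ 2) =
      ∫ x, ballPow n β x • 𝓕 (fun v : E n => Complex.exp (-b * ‖v‖ ^ 2)) x := by
    simpa using! VectorFourier.integral_fourierIntegral_smul_eq_flip (L := innerₗ (E n))
      Real.continuous_fourierChar continuous_inner (integrable_ballPow hn hβ) hgi
  have key : ((∫ x, ‖ballPow n β x‖ * Real.exp (-(Real.pi / r ^ 2) * ‖x‖ ^ 2) : ℝ) : ℂ) =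
      ∫ ξ, 𝓕 (ballPow n β) ξ * ((r : ℂ) ^ n * Complex.exp (-b * ‖ξ‖ ^ 2)) := by
    calc _ = ∫ x, (r : ℂ) ^ n *
          (ballPow n β x • 𝓕 (fun v : E n => Complex.exp (-b * ‖v‖ ^ 2)) x) := by
          rw [← integral_complex_ofReal]
          refine integral_congr_ae (Filter.Eventually.of_forall fun x => ?_)
          simp only
          rw [smul_eq_mul, mul_left_comm, hg, ballPow_eq_norm]
          simp
      _ = _ := by
          rw [integral_const_mul, ← hflip, ← integral_const_mul]
          refine integral_congr_ae (Filter.Eventually.of_forall fun x => ?_)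
          simp only [smul_eq_mul]
          ring
  calc _ ≤ ‖((∫ x, ‖ballPow n β x‖ * Real.exp (-(Real.pi / r ^ 2) * ‖x‖ ^ 2) : ℝ) : ℂ)‖ := by
        rw [Complex.norm_real]
        exact Real.le_norm_self _
    _ ≤ _ := by
        rw [key]
        refine (norm_integral_le_integral_norm _).trans (le_of_eq ?_)
        refine integral_congr_ae (Filter.Eventually.of_forall fun ξ => ?_)
        simp only [norm_mul, norm_pow, Complex.norm_real, Real.norm_of_nonneg hr.le,
          Complex.norm_exp, hb]
        congr 3
        norm_cast

/-- If `β > n (1 - 1 / q)`, then the Fourier transform of `χ_{B_1(0)} |x|^{-β}` is not in `L^q`. -/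
theorem not_integrable_fourier_ballPow (hn : 1 ≤ n) {β q : ℝ} (h0 : 0 ≤ β) (hβ : β < n)
    (hq : 1 < q) (hβq : n * (1 - 1 / q) < β) :
    ¬ Integrable fun ξ => ‖𝓕 (ballPow n β) ξ‖ ^ q := by
  intro hI
  have : Nonempty (Fin n) := ⟨⟨0, hn⟩⟩
  set p := q.conjExponent with hp
  have hpq : q.HolderConjugate p := .conjExponent hq
  have hp0 : 0 < p := hpq.symm.pos
  have hp1 : 1 / p = 1 - 1 / q := by
    have := hpq.inv_add_inv_eq_one
    simp only [one_div]
    linarith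
  set c := Real.exp (-Real.pi) * volume.real (Metric.ball (0 : E n) 1) with hc
  have hcpos : 0 < c := mul_pos (Real.exp_pos _)
    (ENNReal.toReal_pos (Metric.measure_ball_pos _ _ one_pos).ne' measure_ball_lt_top.ne)
  set C := (∫ ξ, ‖𝓕 (ballPow n β) ξ‖ ^ q) ^ (1 / q) * (p⁻¹) ^ ((n : ℝ) / 2 * (1 / p)) with hC
  have hmem : MemLp (fun ξ => ‖𝓕 (ballPow n β) ξ‖) (ENNReal.ofReal q) := by
    rw [← integrable_norm_rpow_iff (continuous_fourier_ballPow hn hβ).norm.aestronglyMeasurable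
      (by simpa using hpq.pos) (by simp), ENNReal.toReal_ofReal hpq.pos.le]
    simpa using hI
  -- Hölder applied to the two Gaussian estimates, divided by `r^{n-β}`.
  have hbound : ∀ r : ℝ, 0 < r → r ≤ 1 → c ≤ C * r ^ (β - n * (1 / p)) := fun r hr hr1 => by
    have hgp : ∀ ξ : E n, (r ^ n * Real.exp (-(Real.pi * r ^ 2) * ‖ξ‖ ^ 2)) ^ p =
        (r ^ n) ^ p * Real.exp (-(Real.pi * r ^ 2 * p) * ‖ξ‖ ^ 2) := fun ξ => by
      rw [Real.mul_rpow (by positivity) (Real.exp_nonneg _), ← Real.exp_mul]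
      congr 2
      ring
    have hb : 0 < Real.pi * r ^ 2 * p := by positivity
    have hgint : Integrable fun ξ : E n => Real.exp (-(Real.pi * r ^ 2 * p) * ‖ξ‖ ^ 2) := by
      have h := (GaussianFourier.integrable_cexp_neg_mul_sq_norm_add
        (b := ((Real.pi * r ^ 2 * p : ℝ) : ℂ)) (by rwa [Complex.ofReal_re]) 0 (0 : E n)).re
      refine h.congr (Filter.Eventually.of_forall fun ξ => ?_)
      have : -((Real.pi * r ^ 2 * p : ℝ) : ℂ) * (‖ξ‖ : ℂ) ^ 2 + 0 * ((inner ℝ 0 ξ : ℝ) : ℂ) =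
          ((-(Real.pi * r ^ 2 * p) * ‖ξ‖ ^ 2 : ℝ) : ℂ) := by push_cast; ring
      simp only
      rw [this, ← Complex.ofReal_exp]
      exact Complex.ofReal_re _
    have hgmem : MemLp (fun ξ : E n => r ^ n * Real.exp (-(Real.pi * r ^ 2) * ‖ξ‖ ^ 2))
        (ENNReal.ofReal p) := by
      rw [← integrable_norm_rpow_iff (by fun_prop : Continuous _).aestronglyMeasurable
        (by simpa using hp0) (by simp), ENNReal.toReal_ofReal hp0.le]
      refine (hgint.const_mul ((r ^ n) ^ p)).congr (Filter.Eventually.of_forall fun ξ => ?_)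
      simp only
      rw [Real.norm_of_nonneg (by positivity), hgp]
    have h := ((le_integral_ballPow_gaussian hn h0 hβ hr hr1).trans
      (integral_ballPow_gaussian_le hn hβ hr)).trans
      (integral_mul_le_Lp_mul_Lq_of_nonneg hpq
        (Filter.Eventually.of_forall fun ξ => norm_nonneg _)
        (Filter.Eventually.of_forall fun ξ => by positivity) hmem hgmem)
    -- The `L^p` norm of the Gaussian scales as `r^{n - n/p}`.
    have hG : (∫ ξ : E n, (r ^ n * Real.exp (-(Real.pi * r ^ 2) * ‖ξ‖ ^ 2)) ^ p) ^ (1 / p) =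
        r ^ n * ((p⁻¹) ^ ((n : ℝ) / 2 * (1 / p)) * r ^ (-(n * (1 / p)))) := by
      simp_rw [hgp]
      rw [integral_const_mul, GaussianFourier.integral_rexp_neg_mul_sq_norm hb,
        finrank_euclideanSpace_fin, Real.mul_rpow (by positivity) (by positivity),
        ← Real.rpow_mul (by positivity), mul_one_div_cancel hp0.ne', Real.rpow_one,
        show Real.pi / (Real.pi * r ^ 2 * p) = p⁻¹ * r ^ (-2 : ℝ) by
          rw [Real.rpow_neg hr.le, Real.rpow_two]; field_simp,
        Real.mul_rpow (by positivity) (by positivity),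
        Real.mul_rpow (by positivity) (by positivity), ← Real.rpow_mul (by positivity),
        ← Real.rpow_mul hr.le, ← Real.rpow_mul hr.le]
      congr 3
      ring
    rw [hG] at h
    have hrn : r ^ ((n : ℝ) - β) = r ^ n * r ^ (-β) := by
      rw [sub_eq_add_neg, Real.rpow_add hr, Real.rpow_natCast]
    have hrβ : r ^ (β - n * (1 / p)) = r ^ (-(n * (1 / p))) * r ^ β := by
      rw [← Real.rpow_add hr]; congr 1; ring
    have hββ : r ^ (-β) * r ^ β = 1 := by rw [← Real.rpow_add hr]; simp
    have hpos : 0 < r ^ n * r ^ (-β) := by positivity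
    refine le_of_mul_le_mul_right ?_ hpos
    rw [hrn, ← hc] at h
    refine h.trans (le_of_eq ?_)
    rw [hC, hrβ]
    linear_combination (-(∫ ξ, ‖𝓕 (ballPow n β) ξ‖ ^ q) ^ (1 / q) *
      (p⁻¹) ^ ((n : ℝ) / 2 * (1 / p)) * r ^ n * r ^ (-(n * (1 / p)))) * hββ
  -- The lower bound on `β` enters here: a positive exponent forces `c ≤ 0` as `r → 0`.
  have hexp : 0 < β - n * (1 / p) := by rw [hp1]; linarith
  have hlim : Filter.Tendsto (fun r : ℝ => C * r ^ (β - n * (1 / p))) (𝓝[>] 0) (𝓝 0) := by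
    have := ((Real.continuous_rpow_const hexp.le).tendsto 0).const_mul C
    rw [Real.zero_rpow hexp.ne', mul_zero] at this
    exact this.mono_left nhdsWithin_le_nhds
  have hev : ∀ᶠ r : ℝ in 𝓝[>] 0, c ≤ C * r ^ (β - n * (1 / p)) := by
    filter_upwards [Ioc_mem_nhdsGT (zero_lt_one' ℝ)] with r hr
    exact hbound r hr.1 hr.2
  exact absurd (ge_of_tendsto hlim hev) (not_le.2 hcpos)

/-- The polar coordinate form of `not_integrable_fourier_ballPow`. -/
theorem lintegral_fourier_ballPow_eq_top (hn : 1 ≤ n) {β q : ℝ} (h0 : 0 ≤ β) (hβ : β < n)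
    (hq : 1 < q) (hβq : n * (1 - 1 / q) < β) {e : E n} (he : ‖e‖ = 1) :
    ∫⁻ a in Ioi (0 : ℝ), ENNReal.ofReal (‖𝓕 (ballPow n β) ((a / (2 * Real.pi)) • e)‖ ^ q) *
      ENNReal.ofReal (a ^ (n - 1)) = ∞ := by
  by_contra hfin
  have : Nonempty (Fin n) := ⟨⟨0, hn⟩⟩
  refine not_integrable_fourier_ballPow hn h0 hβ hq hβq ?_
  have hcont : Continuous fun a : ℝ => ‖𝓕 (ballPow n β) ((a / (2 * Real.pi)) • e)‖ ^ q :=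
    ((continuous_fourier_ballPow hn hβ).comp (by fun_prop)).norm.rpow_const
      fun _ => Or.inr (by linarith)
  have h1 : IntegrableOn (fun a : ℝ => a ^ (Module.finrank ℝ (E n) - 1) •
      ‖𝓕 (ballPow n β) ((a / (2 * Real.pi)) • e)‖ ^ q) (Ioi 0) := by
    rw [finrank_euclideanSpace_fin]
    refine ⟨by fun_prop, ?_⟩
    rw [hasFiniteIntegral_iff_ofReal]
    · refine lt_of_eq_of_lt (setLIntegral_congr_fun measurableSet_Ioi fun a ha => ?_)
        (lt_top_iff_ne_top.2 hfin)
      rw [smul_eq_mul, mul_comm, ENNReal.ofReal_mul (by positivity)]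
    · filter_upwards [ae_restrict_mem measurableSet_Ioi] with a ha
      have : (0 : ℝ) < a := ha
      simp only [Pi.zero_apply]
      positivity
  rw [← integrable_fun_norm_addHaar (volume : Measure (E n))] at h1
  -- A dilation by `(2π)⁻¹` reconciles the frequency `a` with the kernel `e^{-2πi⟨x,ξ⟩}`; radiality
  -- then replaces the direction of `ξ` by `e`.
  rw [← integrable_comp_smul_iff volume _ (inv_ne_zero Real.two_pi_pos.ne')]
  refine h1.congr (Filter.Eventually.of_forall fun ξ => ?_)
  simp only
  congr 2
  refine fourier_ballPow_eq_of_norm_eq β ?_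
  rw [norm_smul, norm_smul, he, div_eq_inv_mul, norm_mul]
  simp

end RadialFourier

/-! ### The operator-valued transform and the trivial class -/

section FourierOperator

open scoped FourierTransform

variable {n : ℕ}

theorem norm_act (k : K n) (x : E n) : ‖act k x‖ = ‖x‖ := by
  have hk : (k.1)ᵀ * k.1 = 1 := mul_eq_one_comm.1 (K.mul_transpose k)
  have h : (k.1 *ᵥ x.ofLp) ⬝ᵥ (k.1 *ᵥ x.ofLp) = x.ofLp ⬝ᵥ x.ofLp := by
    rw [Matrix.dotProduct_mulVec, Matrix.vecMul_mulVec, hk, Matrix.vecMul_one]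
  rw [EuclideanSpace.norm_eq, EuclideanSpace.norm_eq]
  congr 1
  simpa [act, dotProduct, sq] using h

theorem norm_e₁ (hn : 1 ≤ n) : ‖e₁ n‖ = 1 := by
  rw [EuclideanSpace.norm_eq, Real.sqrt_eq_one, Finset.sum_eq_single (⟨0, hn⟩ : Fin n)]
  · simp [e₁]
  · intro i _ hi
    have : (i : ℕ) ≠ 0 := fun h => hi (Fin.ext h)
    simp [e₁, this]
  · simp

/-- The value is independent of `s` because `s⁻¹ · e₁` has the same norm as `e₁` and the transform
is radial; radiality also absorbs the sign of the frequency. -/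
theorem integral_ballPow_mul_phase (β a : ℝ) (s : K n) :
    ∫ x, ballPow n β x * phase a x s = 𝓕 (ballPow n β) ((a / (2 * Real.pi)) • e₁ n) := by
  have h : ‖(a / (2 * Real.pi)) • e₁ n‖ = ‖(-(a / (2 * Real.pi))) • act s⁻¹ (e₁ n)‖ := by
    rw [norm_smul, norm_smul, norm_act, norm_neg]
  rw [fourier_ballPow_eq_of_norm_eq β h, Real.fourier_eq']
  refine integral_congr_ae (Filter.Eventually.of_forall fun x => ?_)
  simp only [phase, ContinuousMap.coe_mk, smul_eq_mul]
  rw [mul_comm, mul_comm Complex.I, inner_smul_right, real_inner_comm]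
  congr 4
  field_simp

theorem integrable_inner_comp_mul_right {d : ℕ} (ψ φ : L2 n d) (k : K n) :
    Integrable (fun s => inner ℂ (ψ s) (φ (s * k))) (haarK n) := by
  refine (L2.integrable_inner (𝕜 := ℂ) ψ (Lp.compMeasurePreserving (· * k)
    (measurePreserving_mul_right (haarK n) k) φ)).congr ?_
  filter_upwards [Lp.coeFn_compMeasurePreserving φ (measurePreserving_mul_right (haarK n) k)]
    with s hs
  rw [hs, Function.comp_apply]

/-- The operator `f̂_β(a,σ)` is a scalar multiple of the average of right translations. -/
theorem inner_fourier_fBeta (hn : 1 ≤ n) {β : ℝ} (hβ : β < n) (a : ℝ) (σ : IrrepU (M n))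
    (ψ φ : Hsp σ) :
    inner ℂ ψ (fourier (fBeta n β) a σ φ) =
      𝓕 (ballPow n β) ((a / (2 * Real.pi)) • e₁ n) *
        ∫ k, ∫ s, inner ℂ (ψ.1 s) (φ.1 (s * k)) ∂haarK n ∂haarK n := by
  have hf := integrable_fBeta hn hβ
  have hi := integrable_smul_rep hf σ a φ
  rw [fourier_apply hf, ← integral_inner hi, haarMotion,
    integral_prod_symm _ (by exact hi.const_inner ψ), ← integral_const_mul]
  refine integral_congr_ae (Filter.Eventually.of_forall fun k => ?_)
  simp only
  have hint : Integrable (fun p : E n × K n =>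
      ballPow n β p.1 * inner ℂ (ψ.1 p.2) (φ.1 (p.2 * k)) * phase a p.1 p.2)
      (volume.prod (haarK n)) := by
    refine ((integrable_ballPow hn hβ).mul_prod
      (integrable_inner_comp_mul_right ψ.1 φ.1 k)).mul_bdd (c := 1) ?_
      (Filter.Eventually.of_forall fun p => ?_)
    · have hc : Continuous fun p : E n × K n => phase a p.1 p.2 :=
        ContinuousEval.continuous_eval.comp
          (((continuous_phase a).comp continuous_fst).prodMk continuous_snd)
      exact hc.aestronglyMeasurable
    · exact ((phase a p.1).norm_coe_le_norm p.2).trans (norm_phase a p.1)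
  calc ∫ x, inner ℂ ψ (fBeta n β (x, k) • rep σ a (x, k) φ)
      = ∫ x, ∫ s, ballPow n β x * inner ℂ (ψ.1 s) (φ.1 (s * k)) * phase a x s ∂haarK n := by
        refine integral_congr_ae (Filter.Eventually.of_forall fun x => ?_)
        simp only
        have h1 : inner ℂ ψ (fBeta n β (x, k) • rep σ a (x, k) φ) =
            fBeta n β (x, k) * inner ℂ ψ.1 (rep σ a (x, k) φ).1 :=
          inner_smul_right (𝕜 := ℂ) ψ.1 (rep σ a (x, k) φ).1 _
        rw [h1, L2.inner_def, ← integral_const_mul]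
        refine integral_congr_ae ?_
        filter_upwards [piL2_apply σ.dim a (x, k) φ.1] with s hs
        have hs' : (rep σ a (x, k) φ).1 s = phase a x s • φ.1 (s * k) := hs
        rw [hs', inner_smul_right]
        change ballPow n β x * _ = _
        ring
    -- After Fubini the inner `x`-integral of the phase is the same scalar for every `s`.
    _ = ∫ s, ∫ x, ballPow n β x * inner ℂ (ψ.1 s) (φ.1 (s * k)) * phase a x s ∂volume ∂haarK n :=
        integral_integral_swap hint
    _ = _ := by
        rw [← integral_const_mul]
        refine integral_congr_ae (Filter.Eventually.of_forall fun s => ?_)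
        simp only
        rw [← integral_ballPow_mul_phase β a s, ← integral_mul_const]
        refine integral_congr_ae (Filter.Eventually.of_forall fun x => ?_)
        simp only
        ring

theorem leftMul_one {d : ℕ} (X : Mat d) : leftMul 1 X = X := by
  ext p
  simp [leftMul, Matrix.one_apply]

/-- A class on which `M` acts trivially contributes at least `|F(a)|^q`. -/
theorem le_schattenNorm_fourier_fBeta (hn : 1 ≤ n) {β q : ℝ} (hβ : β < n) (hq : 0 < q) (a : ℝ)
    {σ : IrrepU (M n)} (hσ : ∀ u, σ.hom u = 1) :
    ENNReal.ofReal (‖𝓕 (ballPow n β) ((a / (2 * Real.pi)) • e₁ n)‖ ^ q) ≤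
      schattenNorm q (fourier (fBeta n β) a σ) ^ q := by
  let i : Fin σ.dim := ⟨0, σ.dim_pos⟩
  let X : Mat σ.dim := EuclideanSpace.single (i, i) 1
  have hX : ‖X‖ = 1 := by simp [X]
  have hc : (Lp.const 2 (haarK n) X : K n → Mat σ.dim) =ᵐ[haarK n] fun _ => X :=
    Lp.coeFn_const ..
  -- Constants satisfy the covariance condition because `M` acts trivially.
  let v : Hsp σ := ⟨Lp.const 2 (haarK n) X, fun u => by
    filter_upwards [hc, (quasiMeasurePreserving_mul_left (haarK n) u.1).ae hc] with k h1 h2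
    rw [h1, h2, hσ u]
    exact (leftMul_one X).symm⟩
  have hv : ‖v‖ = 1 := by
    change ‖Lp.const 2 (haarK n) X‖ = 1
    have h := Lp.norm_const' 2 (haarK n) X (by simp) (by simp)
    rw [hX] at h
    simpa using h
  refine le_schattenNorm_rpow hq hv ?_ fun φ => ?_
  · refine ext_inner_left ℂ fun ψ => ?_
    rw [inner_fourier_fBeta hn hβ, inner_smul_right]
    congr 1
    have h : ∀ k : K n, ∫ s, inner ℂ (ψ.1 s) (v.1 (s * k)) ∂haarK n = inner ℂ ψ v := fun k => by
      rw [Submodule.coe_inner, L2.inner_def]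
      refine integral_congr_ae ?_
      filter_upwards [hc, (quasiMeasurePreserving_mul_right (haarK n) k).ae hc] with s h1 h2
      rw [h1, h2]
    simp_rw [h]
    simp
  -- For the adjoint the translation falls on an arbitrary `φ`, and right invariance of `haarK`
  -- removes it.
  · rw [inner_fourier_fBeta hn hβ]
    congr 1
    have h : ∀ k : K n, ∫ s, inner ℂ (v.1 s) (φ.1 (s * k)) ∂haarK n = inner ℂ v φ := fun k => by
      rw [Submodule.coe_inner, L2.inner_def]
      calc _ = ∫ s, inner ℂ X (φ.1 (s * k)) ∂haarK n := by
            refine integral_congr_ae ?_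
            filter_upwards [hc] with s h1
            rw [h1]
        _ = ∫ s, inner ℂ X (φ.1 s) ∂haarK n :=
            integral_mul_right_eq_self (fun s => (inner ℂ X (φ.1 s) : ℂ)) k
        _ = _ := by
            refine integral_congr_ae ?_
            filter_upwards [hc] with s h1
            rw [h1]
    simp_rw [h]
    simp

/-- The trivial one-dimensional representation. -/
def IrrepU.trivial (G : Type) [Group G] [TopologicalSpace G] : IrrepU G where
  dim := 1
  hom := 1
  continuous_hom := continuous_const
  dim_pos := one_pos
  irreducible W _ := by
    have h : Module.finrank ℂ (Fin 1 → ℂ) = 1 := by simp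
    have := is_simple_module_of_finrank_eq_one (A := ℂ) h
    exact eq_bot_or_eq_top W

/-- Needed because `UnitaryDual.rep` chooses a representative that is only known to be equivalent to
`IrrepU.trivial`. -/
theorem hom_eq_one_of_equivalent_trivial {G : Type} [Group G] [TopologicalSpace G] {σ : IrrepU G}
    (h : σ.Equivalent (IrrepU.trivial G)) (u : G) : σ.hom u = 1 := by
  obtain ⟨U, h1, -, h3⟩ := h
  have h4 : ((IrrepU.trivial G).hom u).1 = 1 := rfl
  apply Subtype.ext
  calc (σ.hom u).1 = (σ.hom u).1 * (U * Uᴴ) := by rw [h1, Matrix.mul_one]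
    _ = 1 := by rw [← Matrix.mul_assoc, h3, h4, Matrix.mul_one, h1]

end FourierOperator

end EuclideanMotion

/-! ### The main theorem -/

theorem mainTheorem5 (n : ℕ) (hn : 3 ≤ n) :
    (∀ β : ℝ, β < n / 2 →
      HasCompactSupport (EuclideanMotion.fBeta n β) ∧
      MemLp (EuclideanMotion.fBeta n β) 2 (EuclideanMotion.haarMotion n) ∧
      Integrable (EuclideanMotion.fBeta n β) (EuclideanMotion.haarMotion n)) ∧
    ∀ q : ℝ, 1 < q → q < 2 → ∃ β ∈ Ioo ((n : ℝ) / 3) ((n : ℝ) / 2),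
      ∫⁻ a in Ioi (0 : ℝ),
        (∑' σ : EuclideanMotion.UnitaryDual (EuclideanMotion.M n),
          (σ.rep.dim : ℝ≥0∞) *
            EuclideanMotion.schattenNorm q
              (EuclideanMotion.fourier (EuclideanMotion.fBeta n β) a σ.rep) ^ q) *
          ENNReal.ofReal (a ^ (n - 1)) = ∞ := by
  have hn1 : 1 ≤ n := by omega
  have hnpos : (0 : ℝ) < n := by positivity
  refine ⟨fun β hβ => ⟨EuclideanMotion.hasCompactSupport_fBeta β,
    EuclideanMotion.memLp_two_fBeta hn1 hβ, EuclideanMotion.integrable_fBeta hn1 (by linarith)⟩,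
    fun q hq1 hq2 => ?_⟩
  have hq : 1 / 2 < 1 / q := one_div_lt_one_div_of_lt (by linarith) hq2
  -- `n / 3` is the required lower end of the interval; `n(1 - 1/q)` is the threshold for
  -- divergence.
  obtain ⟨β, hβ1, hβ2⟩ := exists_between
    (show max ((n : ℝ) / 3) (n * (1 - 1 / q)) < n / 2 from
      max_lt (by linarith) (by nlinarith))
  rw [max_lt_iff] at hβ1
  refine ⟨β, ⟨hβ1.1, hβ2⟩, top_unique ?_⟩
  have hβn : β < n := by linarith
  rw [← EuclideanMotion.lintegral_fourier_ballPow_eq_top hn1 (by linarith) hβn hq1 hβ1.2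
    (EuclideanMotion.norm_e₁ hn1)]
  refine lintegral_mono fun a => mul_le_mul_left ?_ _
  let τ : EuclideanMotion.UnitaryDual (EuclideanMotion.M n) :=
    Quotient.mk _ (EuclideanMotion.IrrepU.trivial (EuclideanMotion.M n))
  have hτ : τ.rep.Equivalent (EuclideanMotion.IrrepU.trivial (EuclideanMotion.M n)) :=
    Quotient.mk_out (s := EuclideanMotion.irrepSetoid (EuclideanMotion.M n)) _
  -- Every term except that of the trivial class is dropped.
  refine le_trans ?_ (ENNReal.le_tsum τ)
  refine (EuclideanMotion.le_schattenNorm_fourier_fBeta hn1 hβn (by linarith) a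
    (EuclideanMotion.hom_eq_one_of_equivalent_trivial hτ)).trans ?_
  exact le_mul_of_one_le_left' (by exact_mod_cast τ.rep.dim_pos)
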